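/- Let $n\ge 2$ and $\mathcal P_n=\{(r,s): 1\le r<s\le n\}$. A pivot ordering is a sequence $\mathcal O$ in which every element of $\mathcal P_n$ appears exactly once; it has length $M=n(n-1)/2$. Two pivot orderings are * equivalent if one is obtained from the other by finitely many transpositions of adjacent terms $(i,j),(i',j')$ with $\{i,j\}\cap\{i',j'\}=\emptyset$; * shift-equivalent if they have the form $[\mathcal O_1,\mathcal O_2]$ and $[\mathcal O_2,\mathcal O_1]$ (concatenations); * weakly equivalent if they are joined by a finite chain of orderings whose neighbouring terms are equivalent or shift-equivalent; * permutation equivalent if there is a permutation $\mathsf q$ of $\{1,\dots,n\}$ such that one is obtained from the other by replacing each term $(i,j)$ with $(\mathsf q(i),\mathsf q(j))$, written with the smaller index first. Let $\mathcal B_c$ be the set of orderings that run through the columns $2,3,\dots,n$ of the strictly upper triangle in this order, taking the positions $(1,j),\dots,(j-1,j)$ inside each column $j$ in an arbitrary order, and let $\mathcal B_r$ be the set of orderings that run through the rows $n-1,n-2,\dots,1$ in this order, taking the positions $(i,i+1),\dots,(i,n)$ inside each row $i$ in an arbitrary order. Let $\mathcal B_{sp}$ consist of the orderings in $\mathcal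 B_c\cup\mathcal B_r$ and their reverses. A pivot ordering $\mathcal O$ is generalized serial if there are pivot orderings $\mathcal O'$ and $\mathcal O''\in\mathcal B_{sp}$ such that either $\mathcal O,\mathcal O'$ are permutation equivalent and $\mathcal O',\mathcal O''$ are weakly equivalent, or $\mathcal O,\mathcal O'$ are weakly equivalent and $\mathcal O',\mathcal O''$ are permutation equivalent. Let $\mathcal O$ be a generalized serial pivot ordering, and let $(i(k),j(k))$, $k\ge 0$, be the sequence of pivot pairs that repeats $\mathcal O$ periodically with period $M$. Let $A\in\mathbb C^{n\times n}$ be any Hermitian matrix, and let $A^{(0)}=A$, $A^{(k+1)}=(U^{(k)})^*A^{(k)}U^{(k)}$ for $k\ge 0$, be a sequence generated by the element-wise complex Jacobi method: with $i=i(k)$, $j=j(k)$ and $A^{(k)}=(a_{rs})$, the matrix $U^{(k)}$ agrees with the identity matrix except for its pivot submatrix $$\begin{bmatrix}u_{ii}&u_{ij}\\u_{ji}&u_{jj}\end{bmatrix}=\begin{bmatrix}\cos\phi&-e^{\imath\alpha}\sin\phi\\ e^{-\imath\alpha}\sin\phi&\cos\phi\end{bmatrix},\qquad \alpha=\arg(a_{ij}),\quad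 \tan2\phi=\frac{2|a_{ij}|}{a_{ii}-a_{jj}},\quad -\frac{\pi}{4}\le\phi\le\frac{\pi}{4}.$$ Here the equation for $\phi$ is understood as $(a_{ii}-a_{jj})\sin2\phi=2|a_{ij}|\cos2\phi$; where these conditions leave a choice of $\alpha$ or $\phi$ (if $a_{ij}=0$ or $a_{ii}=a_{jj}$), any choice is allowed. Then $(A^{(k)})_{k\ge0}$ converges to a diagonal matrix $\Lambda=\operatorname{diag}(\lambda_1,\dots,\lambda_n)$, and $\lambda_1,\dots,\lambda_n$ are the eigenvalues of $A$, each repeated according to its multiplicity, in some order. -/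

import Mathlib

open Matrix Filter Topology

noncomputable section

namespace ComplexJacobi

/-! ### Pivot orderings

Row and column indices are `0, …, n - 1`, i.e. elements of `Fin n`; a pivot position is a pair
`(i, j)` with `i < j`, and an ordering is a finite sequence (list) of pivot positions. -/

/-- `O` is a pivot ordering: a sequence in which every pivot position `(i, j)`, `i < j`, appears
exactly once, and nothing else appears. -/
def IsPivotOrdering {n : ℕ} (O : List (Fin n × Fin n)) : Prop :=
  O.Nodup ∧ ∀ p : Fin n × Fin n, p ∈ O ↔ p.1 < p.2

/-- One admissible transposition: two adjacent terms `p, p'` with disjoint index sets are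
swapped. -/
def AdmissibleTransposition {n : ℕ} (O O' : List (Fin n × Fin n)) : Prop :=
  ∃ (L R : List (Fin n × Fin n)) (p p' : Fin n × Fin n),
    Disjoint ({p.1, p.2} : Set (Fin n)) {p'.1, p'.2} ∧
    O = L ++ p :: p' :: R ∧ O' = L ++ p' :: p :: R

/-- `O ∼ O'`: `O'` arises from `O` by finitely many (possibly zero) admissible transpositions. -/
def Equivalent {n : ℕ} (O O' : List (Fin n × Fin n)) : Prop :=
  Relation.ReflTransGen AdmissibleTransposition O O'

/-- `O = [O₁, O₂]` and `O' = [O₂, O₁]`. -/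
def ShiftEquivalent {n : ℕ} (O O' : List (Fin n × Fin n)) : Prop :=
  ∃ O₁ O₂ : List (Fin n × Fin n), O = O₁ ++ O₂ ∧ O' = O₂ ++ O₁

/-- `O` and `O'` are joined by a finite chain whose adjacent terms are equivalent or
shift-equivalent. -/
def WeakEquivalent {n : ℕ} (O O' : List (Fin n × Fin n)) : Prop :=
  Relation.TransGen (fun P Q => Equivalent P Q ∨ ShiftEquivalent P Q) O O'

/-- The pivot position of the two indices `q i`, `q j`, that is, `(q i, q j)` written with the
smaller index first. -/
def permutePair {n : ℕ} (q : Equiv.Perm (Fin n)) (p : Fin n × Fin n) : Fin n × Fin n :=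
  (min (q p.1) (q p.2), max (q p.1) (q p.2))

/-- `O'` arises from `O` by applying one permutation of the indices to all its terms. -/
def PermutationEquivalent {n : ℕ} (O O' : List (Fin n × Fin n)) : Prop :=
  ∃ q : Equiv.Perm (Fin n), O' = O.map (permutePair q)

/-- Column-by-column orderings (columns from left to right), with an arbitrary arrangement
`τ j` of the positions inside each column `j`. -/
def IsColumnSerial {n : ℕ} (O : List (Fin n × Fin n)) : Prop :=
  ∃ τ : Fin n → List (Fin n),
    (∀ j, (τ j).Nodup ∧ ∀ i, i ∈ τ j ↔ i < j) ∧
    O = (List.finRange n).flatMap fun j => (τ j).map fun i => (i, j)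

/-- Row-by-row orderings (rows from the bottom to the top), with an arbitrary arrangement
`τ i` of the positions inside each row `i`. -/
def IsRowSerial {n : ℕ} (O : List (Fin n × Fin n)) : Prop :=
  ∃ τ : Fin n → List (Fin n),
    (∀ i, (τ i).Nodup ∧ ∀ j, j ∈ τ i ↔ i < j) ∧
    O = (List.finRange n).reverse.flatMap fun i => (τ i).map fun j => (i, j)

/-- Serial pivot orderings with permutations: the column and row orderings above and their
reverses. -/
def IsSerialWithPermutations {n : ℕ} (O : List (Fin n × Fin n)) : Prop :=
  IsColumnSerial O ∨ IsColumnSerial O.reverse ∨ IsRowSerial O ∨ IsRowSerial O.reverse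

/-- Generalized serial pivot orderings. -/
def IsGeneralizedSerial {n : ℕ} (O : List (Fin n × Fin n)) : Prop :=
  IsPivotOrdering O ∧ ∃ O' O'' : List (Fin n × Fin n), IsSerialWithPermutations O'' ∧
    ((PermutationEquivalent O O' ∧ WeakEquivalent O' O'') ∨
      (WeakEquivalent O O' ∧ PermutationEquivalent O' O''))

/-- `I` is the cyclic pivot strategy defined by the ordering `O`: in step `k` the pivot pair is
the term of `O` with number `k` modulo the length of `O`. (There is none if `O` is empty, i.e. if
`n ≤ 1`.) -/
def IsCyclicStrategy {n : ℕ} (O : List (Fin n × Fin n)) (I : ℕ → Fin n × Fin n) : Prop :=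
  ∀ k : ℕ, O[k % O.length]? = some (I k)

/-! ### The element-wise complex Jacobi method -/

/-- The complex rotation in the `(i, j)` plane: the identity matrix, except that its pivot
submatrix is `[[cos φ, -e^{ια} sin φ], [e^{-ια} sin φ, cos φ]]`. -/
def rotation {n : ℕ} (i j : Fin n) (α φ : ℝ) : Matrix (Fin n) (Fin n) ℂ :=
  Matrix.of fun r s =>
    if r = i ∧ s = i then (Real.cos φ : ℂ)
    else if r = i ∧ s = j then -Complex.exp (α * Complex.I) * (Real.sin φ : ℂ)
    else if r = j ∧ s = i then Complex.exp (-(α * Complex.I)) * (Real.sin φ : ℂ)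
    else if r = j ∧ s = j then (Real.cos φ : ℂ)
    else if r = s then 1 else 0

/-- `α` and `φ` are Jacobi angles of the Hermitian matrix `A` at the pivot position `(i, j)`:
`α` is an argument of `a_ij`, `φ ∈ [-π/4, π/4]`, and `tan 2φ = 2|a_ij| / (a_ii - a_jj)`. The last
equation is written without denominators, so that `φ = ± π/4` if `a_ii = a_jj` and `a_ij ≠ 0`. -/
def IsJacobiAngles {n : ℕ} (A : Matrix (Fin n) (Fin n) ℂ) (i j : Fin n) (α φ : ℝ) : Prop :=
  A i j = (‖A i j‖ : ℂ) * Complex.exp (α * Complex.I) ∧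
  -(Real.pi / 4) ≤ φ ∧ φ ≤ Real.pi / 4 ∧
  Real.sin (2 * φ) * ((A i i).re - (A j j).re) = Real.cos (2 * φ) * (2 * ‖A i j‖)

/-- `S 0, S 1, …` is a sequence generated by the element-wise complex Jacobi method from the
Hermitian matrix `A` under the pivot strategy `I`. -/
def IsJacobiSequence {n : ℕ} (I : ℕ → Fin n × Fin n) (A : Matrix (Fin n) (Fin n) ℂ)
    (S : ℕ → Matrix (Fin n) (Fin n) ℂ) : Prop :=
  S 0 = A ∧ ∀ k : ℕ, ∃ α φ : ℝ, IsJacobiAngles (S k) (I k).1 (I k).2 α φ ∧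
    S (k + 1) = (rotation (I k).1 (I k).2 α φ)ᴴ * S k * rotation (I k).1 (I k).2 α φ

end ComplexJacobi

end

/-! A Jacobi step preserves the Frobenius norm and raises the sum of the squared diagonal entries by
twice the squared modulus of the pivot element. That sum is therefore monotone and bounded, so it
converges, and the pivot elements tend to zero (`IsJacobiSequence.diagSq_succ`,
`IsJacobiSequence.tendsto_pivot`).

Let `M` be the period. The iterates numbered `t + M * m` are bounded, so for all `t` at once they
have limits as `m` runs along one ultrafilter. Consecutive limits are joined by limits of the
rotations, and the pivot entry is zero before and after each such step: the limits form a null path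
that runs through the ordering periodically. If only diagonal matrices can start a null path through
enough periods (`IsNondegenerate`), the limit at `t = 0` is diagonal, the diagonal sum of squares
converges to the full squared norm, and the off-diagonal part vanishes
(`IsJacobiSequence.tendsto_diagSq`).

Nondegeneracy is pure combinatorics of null paths. For a column ordering, `NullPath.column_eq_zero`
clears one column at a time. Null paths can be reversed and preserve diagonality, which handles
reversed orderings and shifts; rotations in disjoint planes commute, which handles equivalence;
relabelling the indices handles permutations and turns row orderings into column orderings.

Once the off-diagonal part vanishes, every limit point of the diagonal lists the eigenvalues in some
order, which leaves finitely many candidates. Since the increments of the diagonal tend to zero, it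
cannot keep moving between candidates and converges (`exists_tendsto_of_finite`). -/

namespace ComplexJacobi

/-! ### Unitary matrices acting in a coordinate plane -/

/-- `U` differs from the identity only in the `(i, j)` plane. -/
structure IsPlanar {n : ℕ} (i j : Fin n) (U : Matrix (Fin n) (Fin n) ℂ) : Prop where
  col : ∀ r s, s ≠ i → s ≠ j → U r s = (1 : Matrix (Fin n) (Fin n) ℂ) r s
  row : ∀ r s, r ≠ i → r ≠ j → U r s = (1 : Matrix (Fin n) (Fin n) ℂ) r s

/-- `U` is unitary, differs from the identity only in the `(i, j)` plane, and its diagonal entries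
in this plane are bounded away from zero. -/
structure IsPlaneUnitary {n : ℕ} (i j : Fin n) (U : Matrix (Fin n) (Fin n) ℂ) : Prop
    extends IsPlanar i j U where
  mem : U ∈ Matrix.unitaryGroup (Fin n) ℂ
  -- Any positive constant below `cos (π / 4)` would do. A uniform closed bound survives passage to
  -- the limit, while mere nonvanishing would not; the bound is imposed at both indices to keep the
  -- notion symmetric.
  left : 1 / 2 ≤ ‖U i i‖
  right : 1 / 2 ≤ ‖U j j‖

namespace IsPlanar

variable {n : ℕ} {i j : Fin n} {U : Matrix (Fin n) (Fin n) ℂ}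

theorem swap (h : IsPlanar i j U) : IsPlanar j i U :=
  ⟨fun r s h1 h2 => h.col r s h2 h1, fun r s h1 h2 => h.row r s h2 h1⟩

theorem conjTranspose (h : IsPlanar i j U) : IsPlanar i j Uᴴ where
  col r s h1 h2 := by
    rw [Matrix.conjTranspose_apply, h.row s r h1 h2, ← Matrix.conjTranspose_apply,
      Matrix.conjTranspose_one]
  row r s h1 h2 := by
    rw [Matrix.conjTranspose_apply, h.col s r h1 h2, ← Matrix.conjTranspose_apply,
      Matrix.conjTranspose_one]

theorem mul_apply_of_ne (h : IsPlanar i j U) (A : Matrix (Fin n) (Fin n) ℂ) (r : Fin n)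
    {s : Fin n} (hi : s ≠ i) (hj : s ≠ j) : (A * U) r s = A r s := by
  rw [Matrix.mul_apply]
  simp only [h.col _ s hi hj]
  rw [← Matrix.mul_apply, Matrix.mul_one]

theorem conjTranspose_mul_apply_of_ne (h : IsPlanar i j U) (A : Matrix (Fin n) (Fin n) ℂ)
    {r : Fin n} (hi : r ≠ i) (hj : r ≠ j) (s : Fin n) : (Uᴴ * A) r s = A r s := by
  rw [Matrix.mul_apply]
  simp only [h.conjTranspose.row r _ hi hj]
  rw [← Matrix.mul_apply, Matrix.one_mul]

theorem mul_apply_left (h : IsPlanar i j U) (hij : i ≠ j) (A : Matrix (Fin n) (Fin n) ℂ)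
    (r : Fin n) : (A * U) r i = A r i * U i i + A r j * U j i := by
  rw [Matrix.mul_apply]
  refine Fintype.sum_eq_add i j hij fun x hx => ?_
  rw [h.row x i hx.1 hx.2, Matrix.one_apply_ne hx.1, mul_zero]

theorem conjTranspose_mul_apply_left (h : IsPlanar i j U) (hij : i ≠ j)
    (A : Matrix (Fin n) (Fin n) ℂ) (s : Fin n) :
    (Uᴴ * A) i s = star (U i i) * A i s + star (U j i) * A j s := by
  rw [Matrix.mul_apply]
  refine Fintype.sum_eq_add i j hij fun x hx => ?_
  rw [h.conjTranspose.col i x hx.1 hx.2, Matrix.one_apply_ne hx.1.symm, zero_mul]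

end IsPlanar

namespace IsPlaneUnitary

variable {n : ℕ} {i j : Fin n} {U : Matrix (Fin n) (Fin n) ℂ}

theorem swap (h : IsPlaneUnitary i j U) : IsPlaneUnitary j i U :=
  ⟨h.toIsPlanar.swap, h.mem, h.right, h.left⟩

theorem conjTranspose (h : IsPlaneUnitary i j U) : IsPlaneUnitary i j Uᴴ :=
  ⟨h.toIsPlanar.conjTranspose, Unitary.star_mem h.mem, by simpa using h.left,
    by simpa using h.right⟩

theorem mul_conjTranspose_self (h : IsPlaneUnitary i j U) : U * Uᴴ = 1 :=
  Matrix.mem_unitaryGroup_iff.1 h.mem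

/-- `U - 1` and `V - 1` are supported on disjoint index blocks, so both of their products vanish and
`U * V = U + V - 1 = V * U`. -/
theorem mul_comm_of_disjoint {k l : Fin n} {V : Matrix (Fin n) (Fin n) ℂ}
    (h : IsPlaneUnitary i j U) (h' : IsPlaneUnitary k l V) (hik : i ≠ k) (hil : i ≠ l)
    (hjk : j ≠ k) (hjl : j ≠ l) : U * V = V * U := by
  have key : (U - 1) * (V - 1) = 0 := by
    ext r s
    rw [Matrix.mul_apply]
    refine Finset.sum_eq_zero fun x _ => ?_
    by_cases hx : x = i ∨ x = j
    · have : V x s = (1 : Matrix (Fin n) (Fin n) ℂ) x s := by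
        rcases hx with rfl | rfl
        exacts [h'.row _ _ hik hil, h'.row _ _ hjk hjl]
      rw [Matrix.sub_apply V, this, sub_self, mul_zero]
    · push Not at hx
      rw [Matrix.sub_apply U, h.col _ _ hx.1 hx.2, sub_self, zero_mul]
  have key' : (V - 1) * (U - 1) = 0 := by
    ext r s
    rw [Matrix.mul_apply]
    refine Finset.sum_eq_zero fun x _ => ?_
    by_cases hx : x = i ∨ x = j
    · have : V r x = (1 : Matrix (Fin n) (Fin n) ℂ) r x := by
        rcases hx with rfl | rfl
        exacts [h'.col _ _ hik hil, h'.col _ _ hjk hjl]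
      rw [Matrix.sub_apply V, this, sub_self, zero_mul]
    · push Not at hx
      rw [Matrix.sub_apply U, h.row _ _ hx.1 hx.2, sub_self, mul_zero]
  have h1 : U * V = U + V - 1 := by
    rw [← sub_eq_zero, ← key]; noncomm_ring
  have h2 : V * U = U + V - 1 := by
    rw [← sub_eq_zero, ← key']; noncomm_ring
  rw [h1, h2]

theorem submatrix (h : IsPlaneUnitary i j U) (q : Equiv.Perm (Fin n)) :
    IsPlaneUnitary (q i) (q j) (U.submatrix q.symm q.symm) where
  mem := by
    rw [Matrix.mem_unitaryGroup_iff, Matrix.star_eq_conjTranspose, Matrix.conjTranspose_submatrix,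
      Matrix.submatrix_mul_equiv, h.mul_conjTranspose_self, Matrix.submatrix_one_equiv]
  col r s h1 h2 := by
    rw [Matrix.submatrix_apply, h.col _ _ (by rwa [Ne, Equiv.symm_apply_eq])
      (by rwa [Ne, Equiv.symm_apply_eq])]
    simp [Matrix.one_apply]
  row r s h1 h2 := by
    rw [Matrix.submatrix_apply, h.row _ _ (by rwa [Ne, Equiv.symm_apply_eq])
      (by rwa [Ne, Equiv.symm_apply_eq])]
    simp [Matrix.one_apply]
  left := by simpa using h.left
  right := by simpa using h.right

end IsPlaneUnitary

/-! ### Null steps and null paths -/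

/-- `B` arises from the Hermitian matrix `A` by a unitary transformation in the plane of `p`, and
the pivot element vanishes both before and after the transformation. -/
structure NullStep {n : ℕ} (p : Fin n × Fin n) (A B : Matrix (Fin n) (Fin n) ℂ) : Prop where
  ne : p.1 ≠ p.2
  isHermitian : A.IsHermitian
  source_eq_zero : A p.1 p.2 = 0
  target_eq_zero : B p.1 p.2 = 0
  exists_unitary : ∃ U, IsPlaneUnitary p.1 p.2 U ∧ B = Uᴴ * A * U

/-- `A` and `B` are joined by null steps whose pivot positions are the terms of the list. -/
def NullPath {n : ℕ} :
    List (Fin n × Fin n) → Matrix (Fin n) (Fin n) ℂ → Matrix (Fin n) (Fin n) ℂ → Prop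
  | [], A, B => A = B
  | p :: l, A, B => ∃ C, NullStep p A C ∧ NullPath l C B

section NullPath

variable {n : ℕ} {p : Fin n × Fin n} {A B : Matrix (Fin n) (Fin n) ℂ}

/-- All entries of `A` outside the diagonal with both indices in `T` vanish. -/
def IsDiagOn (T : Set (Fin n)) (A : Matrix (Fin n) (Fin n) ℂ) : Prop :=
  ∀ r ∈ T, ∀ s ∈ T, r ≠ s → A r s = 0

theorem NullStep.isHermitian_target (h : NullStep p A B) : B.IsHermitian := by
  obtain ⟨U, _, rfl⟩ := h.exists_unitary
  exact Matrix.isHermitian_conjTranspose_mul_mul U h.isHermitian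

/-- This symmetry is why a null step asks for a zero pivot on both sides: it makes null paths
reversible. -/
theorem NullStep.symm (h : NullStep p A B) : NullStep p B A := by
  refine ⟨h.ne, h.isHermitian_target, h.target_eq_zero, h.source_eq_zero, ?_⟩
  obtain ⟨U, hU, rfl⟩ := h.exists_unitary
  refine ⟨Uᴴ, hU.conjTranspose, ?_⟩
  rw [Matrix.conjTranspose_conjTranspose]
  calc A = (U * Uᴴ) * A * (U * Uᴴ) := by simp [hU.mul_conjTranspose_self]
    _ = _ := by simp only [Matrix.mul_assoc]

theorem NullStep.swap (h : NullStep p A B) : NullStep p.swap A B := by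
  obtain ⟨U, hU, hB⟩ := h.exists_unitary
  refine ⟨h.ne.symm, h.isHermitian, ?_, ?_, U, hU.swap, hB⟩
  · simpa [h.source_eq_zero] using (h.isHermitian.apply p.2 p.1).symm
  · simpa [h.target_eq_zero] using (h.isHermitian_target.apply p.2 p.1).symm

theorem NullStep.apply_of_ne (h : NullStep p A B) {r s : Fin n} (hr1 : r ≠ p.1) (hr2 : r ≠ p.2)
    (hs1 : s ≠ p.1) (hs2 : s ≠ p.2) : B r s = A r s := by
  obtain ⟨U, hU, rfl⟩ := h.exists_unitary
  rw [hU.mul_apply_of_ne _ _ hs1 hs2, hU.conjTranspose_mul_apply_of_ne _ hr1 hr2]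

/-- A row of `T` outside the plane only has its zero entries in the two plane columns mixed with
each other. Hermitian symmetry treats the columns outside the plane, and inside the plane only the
pivot is left, which is zero by assumption. -/
theorem NullStep.isDiagOn {T : Set (Fin n)} (h : NullStep p A B) (h1 : p.1 ∈ T) (h2 : p.2 ∈ T)
    (hA : IsDiagOn T A) : IsDiagOn T B := by
  obtain ⟨U, hU, hB⟩ := h.exists_unitary
  have key : ∀ r ∈ T, r ≠ p.1 → r ≠ p.2 → ∀ s ∈ T, r ≠ s → B r s = 0 := by
    intro r hr hr1 hr2 s hs hrs
    rw [hB, Matrix.mul_assoc, hU.conjTranspose_mul_apply_of_ne _ hr1 hr2]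
    by_cases hs1 : s = p.1
    · rw [hs1, hU.mul_apply_left h.ne, hA r hr _ h1 hr1, hA r hr _ h2 hr2, zero_mul, zero_mul,
        add_zero]
    by_cases hs2 : s = p.2
    · rw [hs2, hU.swap.mul_apply_left h.ne.symm, hA r hr _ h1 hr1, hA r hr _ h2 hr2, zero_mul,
        zero_mul, add_zero]
    rw [hU.mul_apply_of_ne _ _ hs1 hs2, hA r hr s hs hrs]
  intro r hr s hs hrs
  by_cases hr' : r ≠ p.1 ∧ r ≠ p.2
  · exact key r hr hr'.1 hr'.2 s hs hrs
  by_cases hs' : s ≠ p.1 ∧ s ≠ p.2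
  · rw [← h.isHermitian_target.apply, key s hs hs'.1 hs'.2 r hr hrs.symm, star_zero]
  -- Now both indices lie in the plane and differ, so the entry is the pivot or its transpose.
  have e1 := h.target_eq_zero
  have e2 := h.swap.target_eq_zero
  simp only [Prod.fst_swap, Prod.snd_swap] at e2
  grind

theorem nullPath_append {l l' : List (Fin n × Fin n)} :
    NullPath (l ++ l') A B ↔ ∃ C, NullPath l A C ∧ NullPath l' C B := by
  induction l generalizing A with
  | nil => simp [NullPath]
  | cons p l ih =>
    simp only [List.cons_append, NullPath, ih]
    constructor
    · rintro ⟨C, hC, D, hD, hB⟩; exact ⟨D, ⟨C, hC, hD⟩, hB⟩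
    · rintro ⟨D, ⟨C, hC, hD⟩, hB⟩; exact ⟨C, hC, D, hD, hB⟩

theorem NullPath.reverse {l : List (Fin n × Fin n)} (h : NullPath l A B) :
    NullPath l.reverse B A := by
  induction l generalizing A with
  | nil => exact Eq.symm h
  | cons p l ih =>
    obtain ⟨C, hC, hB⟩ := h
    rw [List.reverse_cons, nullPath_append]
    exact ⟨C, ih hB, A, hC.symm, rfl⟩

theorem NullPath.isDiagOn {T : Set (Fin n)} {l : List (Fin n × Fin n)} (h : NullPath l A B)
    (hl : ∀ p ∈ l, p.1 ∈ T ∧ p.2 ∈ T) (hA : IsDiagOn T A) : IsDiagOn T B := by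
  induction l generalizing A with
  | nil => rwa [← show A = B from h]
  | cons p l ih =>
    obtain ⟨C, hC, hB⟩ := h
    have hp := hl p List.mem_cons_self
    exact ih hB (fun q hq => hl q (List.mem_cons_of_mem p hq)) (hC.isDiagOn hp.1 hp.2 hA)

theorem NullPath.isDiagOn_univ {l : List (Fin n × Fin n)} (h : NullPath l A B)
    (hA : IsDiagOn Set.univ A) : IsDiagOn Set.univ B :=
  h.isDiagOn (fun _ _ => ⟨trivial, trivial⟩) hA

theorem NullPath.isDiagOn_univ_source {l : List (Fin n × Fin n)} (h : NullPath l A B)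
    (hB : IsDiagOn Set.univ B) : IsDiagOn Set.univ A :=
  h.reverse.isDiagOn_univ hB

/-! ### Nondegenerate orderings -/

/-- The list consisting of `N` copies of `O`. -/
def repeated (N : ℕ) (O : List (Fin n × Fin n)) : List (Fin n × Fin n) :=
  (List.replicate N O).flatten

theorem repeated_zero (O : List (Fin n × Fin n)) : repeated 0 O = [] := rfl

theorem repeated_succ (N : ℕ) (O : List (Fin n × Fin n)) :
    repeated (N + 1) O = O ++ repeated N O := by
  simp [repeated, List.replicate_succ]

theorem repeated_succ' (N : ℕ) (O : List (Fin n × Fin n)) :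
    repeated (N + 1) O = repeated N O ++ O := by
  simp [repeated, List.replicate_succ']

/-- Only diagonal matrices admit null paths along sufficiently many repetitions of `O`. -/
def IsNondegenerate (O : List (Fin n × Fin n)) : Prop :=
  ∃ N, ∀ A B, NullPath (repeated N O) A B → IsDiagOn Set.univ A

theorem NullPath.repeated_of_forall {O O' : List (Fin n × Fin n)}
    (h : ∀ A B, NullPath O A B → NullPath O' A B) (N : ℕ) (hAB : NullPath (repeated N O) A B) :
    NullPath (repeated N O') A B := by
  induction N generalizing A with
  | zero => exact hAB
  | succ N ih =>
    rw [repeated_succ, nullPath_append] at hAB ⊢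
    obtain ⟨C, h1, h2⟩ := hAB
    exact ⟨C, h _ _ h1, ih h2⟩

/-- Comparing null paths over a single period is enough, since paths over several periods are
concatenations. -/
theorem IsNondegenerate.of_forall {O O' : List (Fin n × Fin n)} (hO' : IsNondegenerate O')
    (h : ∀ A B, NullPath O A B → NullPath O' A B) : IsNondegenerate O := by
  obtain ⟨N, hN⟩ := hO'
  exact ⟨N, fun A B hAB => hN A B (hAB.repeated_of_forall h N)⟩

/-! ### Invariance of nondegeneracy under reversal, equivalence, shifts and permutations -/

theorem repeated_reverse (N : ℕ) (O : List (Fin n × Fin n)) :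
    repeated N O.reverse = (repeated N O).reverse := by
  induction N with
  | zero => rfl
  | succ N ih => rw [repeated_succ, repeated_succ', List.reverse_append, ih]

theorem IsNondegenerate.of_reverse {O : List (Fin n × Fin n)} (h : IsNondegenerate O.reverse) :
    IsNondegenerate O := by
  obtain ⟨N, hN⟩ := h
  refine ⟨N, fun A B hAB => ?_⟩
  have := hAB.reverse
  rw [← repeated_reverse] at this
  exact hAB.isDiagOn_univ_source (hN _ _ this)

/-- The two rotations commute, and neither changes the pivot entry of the other, so the zero
conditions survive the exchange. -/
theorem NullPath.of_admissibleTransposition {O O' : List (Fin n × Fin n)}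
    (h : AdmissibleTransposition O O') (hAB : NullPath O A B) : NullPath O' A B := by
  obtain ⟨L, R, p, p', hd, rfl, rfl⟩ := h
  rw [nullPath_append] at hAB ⊢
  obtain ⟨C, hC, D, hD, E, hE, hB⟩ := hAB
  rw [Set.disjoint_left] at hd
  have h11 : p.1 ≠ p'.1 := fun h => hd (a := p.1) (by simp) (by simp [h])
  have h12 : p.1 ≠ p'.2 := fun h => hd (a := p.1) (by simp) (by simp [h])
  have h21 : p.2 ≠ p'.1 := fun h => hd (a := p.2) (by simp) (by simp [h])
  have h22 : p.2 ≠ p'.2 := fun h => hd (a := p.2) (by simp) (by simp [h])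
  obtain ⟨U, hU, hUD⟩ := hD.exists_unitary
  obtain ⟨V, hV, hVE⟩ := hE.exists_unitary
  have hUV := hU.mul_comm_of_disjoint hV h11 h12 h21 h22
  have hE' : E = Uᴴ * (Vᴴ * C * V) * U := by
    have : E = (U * V)ᴴ * C * (U * V) := by
      rw [hVE, hUD, Matrix.conjTranspose_mul]; simp only [Matrix.mul_assoc]
    rw [this, hUV, Matrix.conjTranspose_mul]; simp only [Matrix.mul_assoc]
  -- The new intermediate matrix applies `V` first.
  refine ⟨C, hC, Vᴴ * C * V, ⟨hE.ne, hD.isHermitian, ?_, ?_, V, hV, rfl⟩, E,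
    ⟨hD.ne, Matrix.isHermitian_conjTranspose_mul_mul V hD.isHermitian, ?_, ?_, U, hU, hE'⟩, hB⟩
  · rw [← hD.apply_of_ne h11.symm h21.symm h12.symm h22.symm, hE.source_eq_zero]
  · have := hE.target_eq_zero
    rwa [hE', hU.mul_apply_of_ne _ _ h12.symm h22.symm,
      hU.conjTranspose_mul_apply_of_ne _ h11.symm h21.symm] at this
  · rw [hV.mul_apply_of_ne _ _ h21 h22, hV.conjTranspose_mul_apply_of_ne _ h11 h12,
      hD.source_eq_zero]
  · rw [hE.apply_of_ne h11 h12 h21 h22, hD.target_eq_zero]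

theorem IsNondegenerate.of_equivalent {O O' : List (Fin n × Fin n)} (h : Equivalent O O')
    (hO' : IsNondegenerate O') : IsNondegenerate O := by
  induction h using Relation.ReflTransGen.head_induction_on with
  | refl => exact hO'
  | head h _ ih => exact ih.of_forall fun _ _ hAB => hAB.of_admissibleTransposition h

theorem repeated_succ_append (N : ℕ) (O₁ O₂ : List (Fin n × Fin n)) :
    repeated (N + 1) (O₁ ++ O₂) = O₁ ++ repeated N (O₂ ++ O₁) ++ O₂ := by
  induction N with
  | zero => simp [repeated]
  | succ N ih => rw [repeated_succ, ih, repeated_succ N (O₂ ++ O₁)]; simp only [List.append_assoc]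

/-- One extra period of `[O₁, O₂]` contains `N` full periods of `[O₂, O₁]` after an initial `O₁`.
The matrix reached after `O₁` is then diagonal, and reversing the path along `O₁` carries this back
to the start. -/
theorem IsNondegenerate.of_shiftEquivalent {O O' : List (Fin n × Fin n)}
    (h : ShiftEquivalent O O') (hO' : IsNondegenerate O') : IsNondegenerate O := by
  obtain ⟨O₁, O₂, rfl, rfl⟩ := h
  obtain ⟨N, hN⟩ := hO'
  refine ⟨N + 1, fun A B hAB => ?_⟩
  rw [repeated_succ_append, nullPath_append] at hAB
  obtain ⟨D, hAD, _⟩ := hAB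
  obtain ⟨C, hAC, hCD⟩ := nullPath_append.1 hAD
  exact hAC.isDiagOn_univ_source (hN _ _ hCD)

theorem IsNondegenerate.of_weakEquivalent {O O' : List (Fin n × Fin n)}
    (h : WeakEquivalent O O') (hO' : IsNondegenerate O') : IsNondegenerate O := by
  have step : ∀ P Q : List (Fin n × Fin n), Equivalent P Q ∨ ShiftEquivalent P Q →
      IsNondegenerate Q → IsNondegenerate P := by
    rintro P Q (h | h) hQ
    exacts [hQ.of_equivalent h, hQ.of_shiftEquivalent h]
  induction h using Relation.TransGen.head_induction_on with
  | single h => exact step _ _ h hO'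
  | head h _ ih => exact step _ _ h ih

theorem NullStep.submatrix (h : NullStep p A B) (q : Equiv.Perm (Fin n)) :
    NullStep (q p.1, q p.2) (A.submatrix q.symm q.symm) (B.submatrix q.symm q.symm) := by
  obtain ⟨U, hU, rfl⟩ := h.exists_unitary
  refine ⟨q.injective.ne h.ne, h.isHermitian.submatrix _, ?_, ?_, _, hU.submatrix q, ?_⟩
  · simpa using h.source_eq_zero
  · simpa using h.target_eq_zero
  · rw [Matrix.conjTranspose_submatrix, Matrix.submatrix_mul_equiv, Matrix.submatrix_mul_equiv]

/-- Relabelling may reverse the order of the pair; null steps are insensitive to this by Hermitian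
symmetry. -/
theorem NullStep.permutePair (h : NullStep p A B) (q : Equiv.Perm (Fin n)) :
    NullStep (permutePair q p) (A.submatrix q.symm q.symm) (B.submatrix q.symm q.symm) := by
  rcases le_total (q p.1) (q p.2) with hle | hle
  · simpa [ComplexJacobi.permutePair, hle] using h.submatrix q
  · simpa [ComplexJacobi.permutePair, hle] using (h.submatrix q).swap

theorem NullPath.permutePair {l : List (Fin n × Fin n)} (h : NullPath l A B)
    (q : Equiv.Perm (Fin n)) :
    NullPath (l.map (permutePair q)) (A.submatrix q.symm q.symm) (B.submatrix q.symm q.symm) := by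
  induction l generalizing A with
  | nil => rw [show A = B from h]; rfl
  | cons p l ih =>
    obtain ⟨C, hC, hB⟩ := h
    exact ⟨_, hC.permutePair q, ih hB⟩

theorem IsNondegenerate.of_permutationEquivalent {O O' : List (Fin n × Fin n)}
    (h : PermutationEquivalent O O') (hO' : IsNondegenerate O') : IsNondegenerate O := by
  obtain ⟨q, rfl⟩ := h
  obtain ⟨N, hN⟩ := hO'
  refine ⟨N, fun A B hAB r _ s _ hrs => ?_⟩
  have hq := hAB.permutePair q
  have e : (repeated N O).map (ComplexJacobi.permutePair q) =
      repeated N (O.map (ComplexJacobi.permutePair q)) := by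
    simp [repeated, List.map_flatten]
  rw [e] at hq
  simpa using hN _ _ hq (q r) trivial (q s) trivial (q.injective.ne hrs)

/-! ### Serial orderings -/

/-- Induction on the list. A step in the plane of `(i, j)` replaces `A r j` by `A r i * U i j + A r
j * U j j`, and the first summand is zero because `A` is diagonal on the list. The induction
hypothesis makes the new entry zero, and `U j j ≠ 0` then forces `A r j = 0`. -/
theorem NullPath.column_eq_zero {j : Fin n} {l : List (Fin n)} (hl : l.Nodup) (hj : j ∉ l)
    (h : NullPath (l.map fun i => (i, j)) A B) (hA : IsDiagOn {r | r ∈ l} A) :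
    ∀ r ∈ l, A r j = 0 := by
  induction l generalizing A with
  | nil => simp
  | cons i l ih =>
    obtain ⟨C, hC, hB⟩ := h
    rw [List.nodup_cons] at hl
    rw [List.mem_cons, not_or] at hj
    have hne : ∀ r ∈ l, r ≠ i ∧ r ≠ j :=
      fun r hr => ⟨fun e => hl.1 (e ▸ hr), fun e => hj.2 (e ▸ hr)⟩
    have hCl : IsDiagOn {r | r ∈ l} C := fun r hr s hs hrs => by
      rw [hC.apply_of_ne (hne r hr).1 (hne r hr).2 (hne s hs).1 (hne s hs).2]
      exact hA r (List.mem_cons_of_mem i hr) s (List.mem_cons_of_mem i hs) hrs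
    have hCj := ih hl.2 hj.2 hB hCl
    intro r hr
    rcases List.mem_cons.1 hr with rfl | hr'
    · exact hC.source_eq_zero
    obtain ⟨U, hU, rfl⟩ := hC.exists_unitary
    have hr0 := hCj r hr'
    rw [Matrix.mul_assoc, hU.conjTranspose_mul_apply_of_ne _ (hne r hr').1 (hne r hr').2,
      hU.swap.mul_apply_left hC.ne.symm, hA r hr i List.mem_cons_self (hne r hr').1, zero_mul,
      add_zero] at hr0
    refine (mul_eq_zero.1 hr0).resolve_right fun h0 => ?_
    have := hU.right
    simp only [h0, norm_zero] at this
    norm_num at this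

/-- One period is enough. When column `m` is reached, the leading block of order `m` is already
diagonal, so the column above the diagonal must be zero; the steps of that column then keep the
block of order `m + 1` diagonal. -/
theorem IsColumnSerial.isNondegenerate {O : List (Fin n × Fin n)} (h : IsColumnSerial O) :
    IsNondegenerate O := by
  obtain ⟨τ, hτ, rfl⟩ := h
  refine ⟨1, fun A B hAB => ?_⟩
  rw [repeated_succ, repeated_zero, List.append_nil] at hAB
  have key : ∀ m ≤ n, ∀ B, NullPath (((List.finRange n).take m).flatMap fun j =>
      (τ j).map fun i => (i, j)) A B → IsDiagOn {r | (r : ℕ) < m} B := by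
    intro m
    induction m with
    | zero => intro _ B _ r hr; simp at hr
    | succ m ih =>
      intro hm B hB
      have e : (List.finRange n).take (m + 1) = (List.finRange n).take m ++ [⟨m, hm⟩] := by
        rw [List.take_add_one, List.getElem?_eq_getElem (by simpa using hm)]
        simp
      rw [e, List.flatMap_append, nullPath_append] at hB
      obtain ⟨C, hAC, hCB⟩ := hB
      simp only [List.flatMap_cons, List.flatMap_nil, List.append_nil] at hCB
      have hC := ih (by omega) C hAC
      have hmem : ∀ i, i ∈ τ ⟨m, hm⟩ ↔ (i : ℕ) < m := fun i => (hτ ⟨m, hm⟩).2 i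
      have hCH : ∀ r : Fin n, (r : ℕ) < m → C r ⟨m, hm⟩ = 0 := fun r hr =>
        hCB.column_eq_zero (hτ _).1 (by simp [hmem])
          (fun r hr s hs => hC r ((hmem r).1 hr) s ((hmem s).1 hs)) r ((hmem r).2 hr)
      have hCr : ∀ r : Fin n, (r : ℕ) < m → C ⟨m, hm⟩ r = 0 := by
        intro r hr
        -- The Hermitian property of `C` is read off from the first null step of the column; an
        -- empty column leaves no `r` to consider.
        cases hl : τ ⟨m, hm⟩ with
        | nil => exact absurd ((hmem r).2 hr) (by simp [hl])
        | cons i l =>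
          rw [hl] at hCB
          obtain ⟨D, hD, _⟩ := hCB
          rw [← hD.isHermitian.apply, hCH r hr, star_zero]
      refine hCB.isDiagOn (fun p hp => ?_) fun r hr s hs hrs => ?_
      · obtain ⟨i, hi, rfl⟩ := List.mem_map.1 hp
        have := (hmem i).1 hi
        exact ⟨show (i : ℕ) < m + 1 by omega, show m < m + 1 by omega⟩
      · have hr' : (r : ℕ) < m + 1 := hr
        have hs' : (s : ℕ) < m + 1 := hs
        have hrs' : (r : ℕ) ≠ s := fun e => hrs (Fin.ext e)
        rcases Nat.lt_succ_iff_lt_or_eq.1 hr' with h1 | h1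
        · rcases Nat.lt_succ_iff_lt_or_eq.1 hs' with h2 | h2
          · exact hC r h1 s h2 hrs
          · rw [show s = ⟨m, hm⟩ from Fin.ext h2]; exact hCH r h1
        · rw [show r = ⟨m, hm⟩ from Fin.ext h1]; exact hCr s (by omega)
  have hB := key n le_rfl B (by rwa [List.take_of_length_le (by simp)])
  -- The induction shows that the final matrix is diagonal; reversing the path transfers this to
  -- `A`.
  exact hAB.isDiagOn_univ_source fun r _ s _ => hB r r.2 s s.2

/-- Reversing the order of the indices turns rows from the bottom up into columns from left to
right. -/
theorem IsRowSerial.isNondegenerate {O : List (Fin n × Fin n)} (h : IsRowSerial O) :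
    IsNondegenerate O := by
  obtain ⟨τ, hτ, rfl⟩ := h
  refine IsNondegenerate.of_permutationEquivalent ⟨Fin.revPerm, rfl⟩
    (IsColumnSerial.isNondegenerate ⟨fun j => (τ j.rev).map Fin.rev, fun j => ⟨?_, fun i => ?_⟩, ?_⟩)
  · exact (hτ _).1.map Fin.rev_injective
  · rw [List.mem_map]
    constructor
    · rintro ⟨a, ha, rfl⟩
      exact Fin.rev_lt_iff.2 (((hτ _).2 a).1 ha)
    · intro hi
      exact ⟨i.rev, ((hτ _).2 _).2 (Fin.rev_lt_rev.2 hi), Fin.rev_rev i⟩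
  · rw [List.finRange_reverse, List.flatMap_map, List.map_flatMap]
    refine List.flatMap_congr fun j _ => ?_
    rw [List.map_map, List.map_map]
    refine List.map_congr_left fun a ha => ?_
    have : a.rev < j := Fin.rev_lt_iff.2 (((hτ _).2 a).1 ha)
    simp [permutePair, this.le]

theorem IsGeneralizedSerial.isNondegenerate {O : List (Fin n × Fin n)}
    (h : IsGeneralizedSerial O) : IsNondegenerate O := by
  obtain ⟨_, O', O'', hO'', h⟩ := h
  have h'' : IsNondegenerate O'' := by
    rcases hO'' with h | h | h | h
    exacts [h.isNondegenerate, .of_reverse h.isNondegenerate, h.isNondegenerate,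
      .of_reverse h.isNondegenerate]
  rcases h with ⟨h1, h2⟩ | ⟨h1, h2⟩
  · exact (h''.of_weakEquivalent h2).of_permutationEquivalent h1
  · exact (h''.of_permutationEquivalent h2).of_weakEquivalent h1

end NullPath

variable {n : ℕ}

/-! ### One step of the Jacobi method -/

theorem exp_mul_star_exp (α : ℝ) :
    Complex.exp (α * Complex.I) * Complex.exp (-(α * Complex.I)) = 1 := by
  rw [← Complex.exp_add, add_neg_cancel, Complex.exp_zero]

theorem star_exp (α : ℝ) :
    star (Complex.exp (α * Complex.I)) = Complex.exp (-(α * Complex.I)) := by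
  rw [Complex.star_def, ← Complex.exp_conj]; simp

theorem star_exp_neg (α : ℝ) :
    star (Complex.exp (-(α * Complex.I))) = Complex.exp (α * Complex.I) := by
  rw [← star_exp, star_star]

section Rotation

variable {i j : Fin n} (α φ : ℝ)

theorem rotation_left_left : rotation i j α φ i i = (Real.cos φ : ℂ) := by simp [rotation]

theorem rotation_left_right (hij : i ≠ j) :
    rotation i j α φ i j = -Complex.exp (α * Complex.I) * (Real.sin φ : ℂ) := by
  simp [rotation, hij.symm]

theorem rotation_right_left (hij : i ≠ j) :
    rotation i j α φ j i = Complex.exp (-(α * Complex.I)) * (Real.sin φ : ℂ) := by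
  simp [rotation, hij.symm]

theorem rotation_right_right (hij : i ≠ j) : rotation i j α φ j j = (Real.cos φ : ℂ) := by
  simp [rotation, hij.symm]

theorem isPlanar_rotation : IsPlanar i j (rotation i j α φ) where
  col r s h1 h2 := by simp [rotation, h1, h2, Matrix.one_apply]
  row r s h1 h2 := by simp [rotation, h1, h2, Matrix.one_apply]

theorem ofReal_cos_sq_add_sin_sq :
    (Real.cos φ : ℂ) ^ 2 + (Real.sin φ : ℂ) ^ 2 = 1 := by
  exact_mod_cast Real.cos_sq_add_sin_sq φ

theorem rotation_mem_unitaryGroup (hij : i ≠ j) :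
    rotation i j α φ ∈ Matrix.unitaryGroup (Fin n) ℂ := by
  rw [Matrix.mem_unitaryGroup_iff', Matrix.star_eq_conjTranspose]
  have hP := isPlanar_rotation (i := i) (j := j) α φ
  have hcs := ofReal_cos_sq_add_sin_sq φ
  have he := exp_mul_star_exp α
  have hr : ∀ x : ℝ, star (x : ℂ) = x := Complex.conj_ofReal
  ext r s
  by_cases hrn : r ≠ i ∧ r ≠ j
  · rw [hP.conjTranspose_mul_apply_of_ne _ hrn.1 hrn.2, hP.row _ _ hrn.1 hrn.2]
  by_cases hsn : s ≠ i ∧ s ≠ j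
  · rw [hP.mul_apply_of_ne _ _ hsn.1 hsn.2, hP.conjTranspose.col _ _ hsn.1 hsn.2]
  have hr' : r = i ∨ r = j := by tauto
  have hs' : s = i ∨ s = j := by tauto
  rcases hr' with rfl | rfl <;> rcases hs' with rfl | rfl
  · rw [hP.conjTranspose_mul_apply_left hij, rotation_left_left, rotation_right_left _ _ hij,
      star_mul', hr, hr, star_exp_neg, Matrix.one_apply_eq]
    linear_combination hcs + (Real.sin φ : ℂ) ^ 2 * he
  · rw [hP.conjTranspose_mul_apply_left hij, rotation_left_left, rotation_right_left _ _ hij,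
      rotation_left_right _ _ hij, rotation_right_right _ _ hij,
      star_mul', hr, hr, star_exp_neg, Matrix.one_apply_ne hij]
    ring
  · rw [hP.swap.conjTranspose_mul_apply_left hij.symm, rotation_left_left,
      rotation_right_left _ _ hij, rotation_left_right _ _ hij, rotation_right_right _ _ hij,
      star_mul', star_neg, hr, hr, star_exp, Matrix.one_apply_ne hij.symm]
    ring
  · rw [hP.swap.conjTranspose_mul_apply_left hij.symm,
      rotation_left_right _ _ hij, rotation_right_right _ _ hij,
      star_mul', star_neg, hr, hr, star_exp, Matrix.one_apply_eq]
    linear_combination hcs + (Real.sin φ : ℂ) ^ 2 * he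

theorem half_le_cos {φ : ℝ} (h1 : -(Real.pi / 4) ≤ φ) (h2 : φ ≤ Real.pi / 4) :
    1 / 2 ≤ Real.cos φ := by
  rw [← Real.cos_pi_div_three, ← Real.cos_abs φ]
  have hpi := Real.pi_pos
  have := abs_le.2 ⟨h1, h2⟩
  exact Real.cos_le_cos_of_nonneg_of_le_pi (abs_nonneg φ) (by linarith) (by linarith)

theorem isPlaneUnitary_rotation (hij : i ≠ j) {φ : ℝ} (h1 : -(Real.pi / 4) ≤ φ)
    (h2 : φ ≤ Real.pi / 4) : IsPlaneUnitary i j (rotation i j α φ) := by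
  have h := half_le_cos h1 h2
  refine ⟨isPlanar_rotation α φ, rotation_mem_unitaryGroup α φ hij, ?_, ?_⟩
  · rw [rotation_left_left, Complex.norm_real]; exact h.trans (le_abs_self _)
  · rw [rotation_right_right _ _ hij, Complex.norm_real]; exact h.trans (le_abs_self _)

end Rotation

/-! ### Effect of one rotation on the pivot, the diagonal and the sums of squares -/

section JacobiStep

variable {A : Matrix (Fin n) (Fin n) ℂ} {i j : Fin n} {α φ : ℝ}

theorem IsJacobiAngles.sin_mul_cos (h : IsJacobiAngles A i j α φ) :
    Real.sin φ * Real.cos φ * ((A i i).re - (A j j).re) =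
      (Real.cos φ ^ 2 - Real.sin φ ^ 2) * ‖A i j‖ := by
  have := h.2.2.2
  rw [Real.sin_two_mul, Real.cos_two_mul'] at this
  linarith

theorem IsJacobiAngles.apply_swap (h : IsJacobiAngles A i j α φ) (hA : A.IsHermitian) :
    A j i = (‖A i j‖ : ℂ) * Complex.exp (-(α * Complex.I)) := by
  rw [← hA.apply, h.1, star_mul', star_exp, ← h.1]
  simp

/-- The Jacobi rotation annihilates the pivot element. -/
theorem IsJacobiAngles.conj_pivot (h : IsJacobiAngles A i j α φ) (hA : A.IsHermitian)
    (hij : i ≠ j) :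
    ((rotation i j α φ)ᴴ * A * rotation i j α φ) i j = 0 := by
  have hP := isPlanar_rotation (i := i) (j := j) α φ
  have hs : (Real.sin φ : ℂ) * Real.cos φ * ((A i i).re - (A j j).re) =
      ((Real.cos φ : ℂ) ^ 2 - (Real.sin φ : ℂ) ^ 2) * ‖A i j‖ := by
    exact_mod_cast h.sin_mul_cos
  have hr : ∀ x : ℝ, star (x : ℂ) = x := Complex.conj_ofReal
  have h1 := h.1
  have h2 := h.apply_swap hA
  have he := exp_mul_star_exp α
  rw [Matrix.mul_assoc, hP.conjTranspose_mul_apply_left hij,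
    hP.swap.mul_apply_left hij.symm, hP.swap.mul_apply_left hij.symm, rotation_left_left,
    rotation_right_left _ _ hij, rotation_left_right _ _ hij, rotation_right_right _ _ hij,
    star_mul', hr, hr, star_exp_neg, h2]
  rw [← hA.coe_re_apply_self i, ← hA.coe_re_apply_self j]
  simp only [RCLike.re_eq_complex_re, Complex.coe_algebraMap]
  generalize ‖A i j‖ = β at *
  rw [h1]
  generalize Complex.exp (α * Complex.I) = e at *
  generalize Complex.exp (-(α * Complex.I)) = e' at *
  push_cast at *
  linear_combination -e * hs - e * β * (Complex.sin φ) ^ 2 * he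

theorem IsJacobiAngles.conj_left (h : IsJacobiAngles A i j α φ) (hA : A.IsHermitian)
    (hij : i ≠ j) :
    (((rotation i j α φ)ᴴ * A * rotation i j α φ) i i).re =
      Real.cos φ ^ 2 * (A i i).re + 2 * Real.cos φ * Real.sin φ * ‖A i j‖ +
        Real.sin φ ^ 2 * (A j j).re := by
  have hP := isPlanar_rotation (i := i) (j := j) α φ
  have hr : ∀ x : ℝ, star (x : ℂ) = x := Complex.conj_ofReal
  have h1 := h.1
  have h2 := h.apply_swap hA
  have he := exp_mul_star_exp α
  rw [← Complex.ofReal_re (_ + _)]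
  congr 1
  rw [Matrix.mul_assoc, hP.conjTranspose_mul_apply_left hij,
    hP.mul_apply_left hij, hP.mul_apply_left hij, rotation_left_left,
    rotation_right_left _ _ hij,
    star_mul', hr, hr, star_exp_neg, h2]
  rw [← hA.coe_re_apply_self i, ← hA.coe_re_apply_self j]
  simp only [RCLike.re_eq_complex_re, Complex.coe_algebraMap, Complex.ofReal_re]
  generalize ‖A i j‖ = β at *
  rw [h1]
  generalize Complex.exp (α * Complex.I) = e at *
  generalize Complex.exp (-(α * Complex.I)) = e' at *
  push_cast
  linear_combination (2 * Complex.cos φ * Complex.sin φ * β +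
    (A j j).re * (Complex.sin φ) ^ 2) * he

theorem IsJacobiAngles.conj_right (h : IsJacobiAngles A i j α φ) (hA : A.IsHermitian)
    (hij : i ≠ j) :
    (((rotation i j α φ)ᴴ * A * rotation i j α φ) j j).re =
      Real.sin φ ^ 2 * (A i i).re - 2 * Real.cos φ * Real.sin φ * ‖A i j‖ +
        Real.cos φ ^ 2 * (A j j).re := by
  have hP := isPlanar_rotation (i := i) (j := j) α φ
  have hr : ∀ x : ℝ, star (x : ℂ) = x := Complex.conj_ofReal
  have h1 := h.1
  have h2 := h.apply_swap hA
  have he := exp_mul_star_exp α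
  rw [← Complex.ofReal_re (_ + _)]
  congr 1
  rw [Matrix.mul_assoc, hP.swap.conjTranspose_mul_apply_left hij.symm,
    hP.swap.mul_apply_left hij.symm, hP.swap.mul_apply_left hij.symm,
    rotation_left_right _ _ hij, rotation_right_right _ _ hij,
    star_mul', star_neg, hr, hr, star_exp, h2]
  rw [← hA.coe_re_apply_self i, ← hA.coe_re_apply_self j]
  simp only [RCLike.re_eq_complex_re, Complex.coe_algebraMap, Complex.ofReal_re]
  generalize ‖A i j‖ = β at *
  rw [h1]
  generalize Complex.exp (α * Complex.I) = e at *
  generalize Complex.exp (-(α * Complex.I)) = e' at *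
  push_cast
  linear_combination (-2 * Complex.cos φ * Complex.sin φ * β +
    (A i i).re * (Complex.sin φ) ^ 2) * he

/-- The sum of the squared diagonal entries. -/
noncomputable def diagSq (A : Matrix (Fin n) (Fin n) ℂ) : ℝ := ∑ r, (A r r).re ^ 2

/-- The squared Frobenius norm. -/
noncomputable def frobSq (A : Matrix (Fin n) (Fin n) ℂ) : ℝ := ∑ r, ∑ s, ‖A r s‖ ^ 2

theorem frobSq_eq_trace (A : Matrix (Fin n) (Fin n) ℂ) : (frobSq A : ℂ) = (Aᴴ * A).trace := by
  simp only [frobSq, Matrix.trace, Matrix.diag, Matrix.mul_apply, Matrix.conjTranspose_apply]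
  rw [Finset.sum_comm]
  push_cast
  refine Finset.sum_congr rfl fun r _ => Finset.sum_congr rfl fun s _ => ?_
  rw [Complex.star_def, Complex.conj_mul']

theorem IsPlaneUnitary.frobSq_conj {U : Matrix (Fin n) (Fin n) ℂ} (hU : IsPlaneUnitary i j U) :
    frobSq (Uᴴ * A * U) = frobSq A := by
  have : (frobSq (Uᴴ * A * U) : ℂ) = frobSq A := by
    rw [frobSq_eq_trace, frobSq_eq_trace]
    calc ((Uᴴ * A * U)ᴴ * (Uᴴ * A * U)).trace
        = (Uᴴ * Aᴴ * (U * Uᴴ) * A * U).trace := by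
          simp only [Matrix.conjTranspose_mul, Matrix.conjTranspose_conjTranspose,
            Matrix.mul_assoc]
      _ = (Uᴴ * (Aᴴ * A * U)).trace := by
          rw [hU.mul_conjTranspose_self]; simp only [Matrix.mul_assoc, Matrix.one_mul]
      _ = (Aᴴ * A).trace := by
          rw [Matrix.trace_mul_comm, Matrix.mul_assoc, hU.mul_conjTranspose_self, Matrix.mul_one]
  exact_mod_cast this

theorem IsJacobiAngles.diagSq_conj (h : IsJacobiAngles A i j α φ) (hA : A.IsHermitian)
    (hij : i ≠ j) :
    diagSq ((rotation i j α φ)ᴴ * A * rotation i j α φ) = diagSq A + 2 * ‖A i j‖ ^ 2 := by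
  have hP := isPlanar_rotation (i := i) (j := j) α φ
  rw [← sub_eq_iff_eq_add', diagSq, diagSq, ← Finset.sum_sub_distrib,
    Fintype.sum_eq_add i j hij]
  · rw [h.conj_left hA hij, h.conj_right hA hij]
    have h1 := h.sin_mul_cos
    have h2 := Real.cos_sq_add_sin_sq φ
    generalize Real.cos φ = c at *
    generalize Real.sin φ = s at *
    generalize (A i i).re = a at *
    generalize (A j j).re = d at *
    generalize ‖A i j‖ = β at *
    -- The squared norm of the pivot block scales by `(c ^ 2 + s ^ 2) ^ 2 = 1`; the subtracted term
    -- is twice the square of the new pivot, which `h1` makes zero.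
    linear_combination (a ^ 2 + d ^ 2 + 2 * β ^ 2) * (c ^ 2 + s ^ 2 + 1) * h2 -
      2 * (s * c * (a - d) - (c ^ 2 - s ^ 2) * β) * h1
  · intro r hr
    rw [hP.mul_apply_of_ne _ _ hr.1 hr.2, hP.conjTranspose_mul_apply_of_ne _ hr.1 hr.2, sub_self]

/-- The two affected diagonal entries change by `± tan φ * ‖A i j‖`. The factor 2 comes from the
crude bounds `|sin φ| ≤ 1` and `cos φ ≥ 1 / 2`. -/
theorem IsJacobiAngles.abs_diag_sub_le (h : IsJacobiAngles A i j α φ) (hA : A.IsHermitian)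
    (hij : i ≠ j) (r : Fin n) :
    |(((rotation i j α φ)ᴴ * A * rotation i j α φ) r r).re - (A r r).re| ≤ 2 * ‖A i j‖ := by
  have hP := isPlanar_rotation (i := i) (j := j) α φ
  have h1 := h.sin_mul_cos
  have h2 := Real.cos_sq_add_sin_sq φ
  have h3 := half_le_cos h.2.1 h.2.2.1
  have h4 := Real.abs_sin_le_one φ
  have key : ∀ x, Real.cos φ * x = Real.sin φ * ‖A i j‖ → |x| ≤ 2 * ‖A i j‖ := by
    intro x hx
    have := congrArg abs hx
    rw [abs_mul, abs_mul, abs_of_nonneg (by linarith : 0 ≤ Real.cos φ), abs_norm] at this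
    have h5 : |Real.sin φ| * ‖A i j‖ ≤ 1 * ‖A i j‖ := by gcongr
    have h6 : 1 / 2 * |x| ≤ Real.cos φ * |x| := by gcongr
    linarith
  by_cases hri : r = i
  · rw [hri, h.conj_left hA hij]
    apply key
    linear_combination (-Real.sin φ) * h1 + (Real.cos φ * (A i i).re +
      Real.sin φ * ‖A i j‖) * h2
  by_cases hrj : r = j
  · rw [hrj, h.conj_right hA hij, abs_sub_comm]
    apply key
    linear_combination (-Real.sin φ) * h1 + (-Real.cos φ * (A j j).re +
      Real.sin φ * ‖A i j‖) * h2
  rw [hP.mul_apply_of_ne _ _ hri hrj, hP.conjTranspose_mul_apply_of_ne _ hri hrj, sub_self,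
    abs_zero]
  positivity

end JacobiStep

/-! ### Limits along ultrafilters -/

theorem exists_tendsto_of_bounded {ι : Type*} (𝒰 : Ultrafilter ι)
    (f : ι → Matrix (Fin n) (Fin n) ℂ) (C : ℝ) (hf : ∀ k r s, ‖f k r s‖ ≤ C) :
    ∃ L, Tendsto f 𝒰 (𝓝 L) := by
  have h : ∀ r s, ∃ z : ℂ, Tendsto (fun k => f k r s) 𝒰 (𝓝 z) := by
    intro r s
    obtain ⟨z, _, hz⟩ := (isCompact_closedBall (0 : ℂ) C).ultrafilter_le_nhds
      (𝒰.map fun k => f k r s)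
      (by
        rw [Filter.le_principal_iff]
        exact Filter.mem_map.2 (Filter.Eventually.of_forall fun k => by simpa using hf k r s))
    exact ⟨z, hz⟩
  choose L hL using h
  exact ⟨Matrix.of L, tendsto_pi_nhds.2 fun r => tendsto_pi_nhds.2 fun s => hL r s⟩

theorem tendsto_matrix_apply {ι : Type*} {l : Filter ι} {f : ι → Matrix (Fin n) (Fin n) ℂ}
    {L : Matrix (Fin n) (Fin n) ℂ} (h : Tendsto f l (𝓝 L)) (r s : Fin n) :
    Tendsto (fun k => f k r s) l (𝓝 (L r s)) :=
  tendsto_pi_nhds.1 (tendsto_pi_nhds.1 h r) s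

/-- A sequence with vanishing increments whose limits along ultrafilters lie in a finite set
converges to a point of this set. -/
theorem exists_tendsto_of_finite {X : Type*} [MetricSpace X] {E : Set X} (hE : E.Finite)
    {x : ℕ → X} (hx : ∀ 𝒰 : Ultrafilter ℕ, (𝒰 : Filter ℕ) ≤ atTop → ∃ e ∈ E, Tendsto x 𝒰 (𝓝 e))
    (hd : Tendsto (fun k => dist (x (k + 1)) (x k)) atTop (𝓝 0)) :
    ∃ e ∈ E, Tendsto x atTop (𝓝 e) := by
  have near : ∀ ε > 0, ∀ᶠ k in atTop, ∃ e ∈ E, dist (x k) e < ε := by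
    intro ε hε
    refine Filter.mem_iff_ultrafilter.2 fun 𝒰 h𝒰 => ?_
    obtain ⟨e, he, hxe⟩ := hx 𝒰 h𝒰
    filter_upwards [hxe (Metric.ball_mem_nhds e hε)] with k hk
    exact ⟨e, he, hk⟩
  -- The nonzero distances within `E` form a finite, hence closed, set that avoids 0, so they are
  -- bounded below by some `δ`.
  obtain ⟨δ, hδ, hsep⟩ : ∃ δ > 0, ∀ e ∈ E, ∀ e' ∈ E, dist e e' < δ → e = e' := by
    have hfin : ((fun p : X × X => dist p.1 p.2) '' (E ×ˢ E) \ {0}).Finite :=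
      ((hE.prod hE).image _).subset Set.sdiff_subset
    have hnhds := hfin.isClosed.isOpen_compl.mem_nhds
      (show (0 : ℝ) ∈ ((fun p : X × X => dist p.1 p.2) '' (E ×ˢ E) \ {0})ᶜ by simp)
    obtain ⟨δ, hδ, hball⟩ := Metric.mem_nhds_iff.1 hnhds
    refine ⟨δ, hδ, fun e he e' he' hlt => ?_⟩
    by_contra hne
    refine hball (show dist e e' ∈ Metric.ball 0 δ by simpa using hlt) ⟨⟨(e, e'), ⟨he, he'⟩, rfl⟩, ?_⟩
    simpa using hne
  obtain ⟨K, hK⟩ := Filter.eventually_atTop.1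
    ((near (δ / 3) (by positivity)).and (hd.eventually (gt_mem_nhds (by positivity : 0 < δ / 3))))
  obtain ⟨e, he, hxe⟩ := (hK K le_rfl).1
  -- Two distances to `E` and one increment, each below `δ / 3`, place consecutive nearby points of
  -- `E` within `δ` of each other, so they coincide.
  have stay : ∀ k ≥ K, dist (x k) e < δ / 3 := by
    intro k hk
    induction k, hk using Nat.le_induction with
    | base => exact hxe
    | succ k hk ih =>
      obtain ⟨e', he', hxe'⟩ := (hK (k + 1) (by omega)).1
      have h1 := (hK k hk).2
      have h2 : dist e e' ≤ dist (x k) e + dist (x (k + 1)) (x k) + dist (x (k + 1)) e' := by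
        rw [dist_comm (x k) e, dist_comm (x (k + 1)) (x k)]
        exact dist_triangle4 _ _ _ _
      rwa [hsep e he e' he' (by linarith)]
  refine ⟨e, he, Metric.tendsto_atTop'.2 fun ε hε => ?_⟩
  obtain ⟨K', hK'⟩ := Filter.eventually_atTop.1 (near (min ε (δ / 3)) (by positivity))
  refine ⟨max K K', fun k hk => ?_⟩
  have hk1 : K ≤ k := (le_max_left _ _).trans hk.le
  obtain ⟨e', he', hxe'⟩ := hK' k ((le_max_right _ _).trans hk.le)
  have h2 := dist_triangle_left e e' (x k)
  have h3 := stay k hk1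
  have h4 := hxe'.trans_le (min_le_right _ _)
  rw [hsep e he e' he' (by linarith)]
  exact hxe'.trans_le (min_le_left _ _)

/-! ### Spectra -/

/-- Equal multiplicities mean equinumerous fibres, and bijections between the fibres glue to a
permutation. -/
theorem exists_perm_of_map_univ_eq {ι α : Type*} [Fintype ι] (f g : ι → α)
    (h : Multiset.map f Finset.univ.val = Multiset.map g Finset.univ.val) :
    ∃ σ : Equiv.Perm ι, ∀ i, f i = g (σ i) := by
  classical
  have hc : ∀ c, Nonempty ({i // f i = c} ≃ {i // g i = c}) := by
    intro c
    rw [← Fintype.card_eq, Fintype.card_subtype, Fintype.card_subtype]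
    have := congrArg (Multiset.count c) h
    rw [Multiset.count_map, Multiset.count_map] at this
    simpa only [Finset.card, Finset.filter_val, eq_comm] using this
  exact ⟨Equiv.ofFiberEquiv fun c => (hc c).some, fun i => (Equiv.ofFiberEquiv_map _ i).symm⟩

theorem exists_perm_eigenvalues {A : Matrix (Fin n) (Fin n) ℂ} (hA : A.IsHermitian)
    (d : Fin n → ℝ) (h : (Matrix.diagonal fun i => (d i : ℂ)).charpoly = A.charpoly) :
    ∃ σ : Equiv.Perm (Fin n), ∀ i, d i = hA.eigenvalues (σ i) := by
  apply exists_perm_of_map_univ_eq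
  have h1 := hA.roots_charpoly_eq_eigenvalues
  rw [← h, Matrix.charpoly_diagonal, Polynomial.roots_prod _ _
    (by simp [Finset.prod_ne_zero_iff, Polynomial.X_sub_C_ne_zero])] at h1
  have h2 := congrArg (Multiset.map Complex.re) h1
  simpa [Multiset.map_map, Function.comp_def] using h2

theorem IsPlaneUnitary.charpoly_conj {i j : Fin n} {U : Matrix (Fin n) (Fin n) ℂ}
    (hU : IsPlaneUnitary i j U) (A : Matrix (Fin n) (Fin n) ℂ) :
    (Uᴴ * A * U).charpoly = A.charpoly := by
  rw [Matrix.mul_assoc, Matrix.charpoly_mul_comm, Matrix.mul_assoc, hU.mul_conjTranspose_self,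
    Matrix.mul_one]

/-- The value of the characteristic polynomial at each point is a determinant, hence continuous in
the matrix. -/
theorem charpoly_eq_of_tendsto {ι : Type*} {l : Filter ι} [l.NeBot]
    {f : ι → Matrix (Fin n) (Fin n) ℂ} {L A : Matrix (Fin n) (Fin n) ℂ} (h : Tendsto f l (𝓝 L))
    (hf : ∀ k, (f k).charpoly = A.charpoly) : L.charpoly = A.charpoly := by
  refine Polynomial.funext fun x => ?_
  have hcont : Continuous fun B : Matrix (Fin n) (Fin n) ℂ => B.charpoly.eval x := by
    simp only [Matrix.eval_charpoly]
    exact (continuous_const.sub continuous_id).matrix_det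
  have h1 := (hcont.tendsto L).comp h
  simp only [Function.comp_def, hf] at h1
  exact tendsto_nhds_unique h1 tendsto_const_nhds

/-! ### Jacobi sequences -/

theorem NullPath.of_sequence {I : ℕ → Fin n × Fin n} {L : ℕ → Matrix (Fin n) (Fin n) ℂ}
    (h : ∀ t, NullStep (I t) (L t) (L (t + 1))) (m a : ℕ) :
    NullPath ((List.range' a m).map I) (L a) (L (a + m)) := by
  induction m generalizing a with
  | zero => rfl
  | succ m ih =>
    refine ⟨L (a + 1), h a, ?_⟩
    have := ih (a + 1)
    rwa [Nat.add_right_comm] at this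

theorem IsCyclicStrategy.length_pos {O : List (Fin n × Fin n)} {I : ℕ → Fin n × Fin n}
    (hI : IsCyclicStrategy O I) : 0 < O.length := by
  rcases O with _ | ⟨p, O⟩
  · simpa using hI 0
  · simp

theorem IsCyclicStrategy.add_mul {O : List (Fin n × Fin n)} {I : ℕ → Fin n × Fin n}
    (hI : IsCyclicStrategy O I) (t m : ℕ) : I (t + O.length * m) = I t := by
  have h1 := hI (t + O.length * m)
  rw [Nat.add_mul_mod_self_left, hI t] at h1
  exact (Option.some.inj h1).symm

theorem IsCyclicStrategy.map_range' {O : List (Fin n × Fin n)} {I : ℕ → Fin n × Fin n}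
    (hI : IsCyclicStrategy O I) (m : ℕ) :
    (List.range' (O.length * m) O.length).map I = O := by
  refine List.ext_getElem (by simp) fun t h1 h2 => ?_
  have h3 := hI t
  rw [Nat.mod_eq_of_lt h2, List.getElem?_eq_getElem h2] at h3
  rw [List.getElem_map, List.getElem_range', one_mul, Nat.add_comm, hI.add_mul]
  exact (Option.some.inj h3).symm

theorem IsCyclicStrategy.nullPath_repeated {O : List (Fin n × Fin n)} {I : ℕ → Fin n × Fin n}
    (hI : IsCyclicStrategy O I) {L : ℕ → Matrix (Fin n) (Fin n) ℂ}
    (h : ∀ t, NullStep (I t) (L t) (L (t + 1))) (N : ℕ) :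
    NullPath (repeated N O) (L 0) (L (O.length * N)) := by
  induction N with
  | zero => rfl
  | succ N ih =>
    rw [repeated_succ', nullPath_append]
    refine ⟨_, ih, ?_⟩
    have := NullPath.of_sequence h O.length (O.length * N)
    rwa [hI.map_range'] at this

theorem IsJacobiSequence.isHermitian {I : ℕ → Fin n × Fin n} {A : Matrix (Fin n) (Fin n) ℂ}
    {S : ℕ → Matrix (Fin n) (Fin n) ℂ} (hS : IsJacobiSequence I A S) (hA : A.IsHermitian) (k : ℕ) :
    (S k).IsHermitian := by
  induction k with
  | zero => rwa [hS.1]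
  | succ k ih =>
    obtain ⟨α, φ, _, h⟩ := hS.2 k
    rw [h]
    exact Matrix.isHermitian_conjTranspose_mul_mul _ ih

/-! ### Invariants, monotonicity and convergence along the iteration -/

section Sequence

variable {I : ℕ → Fin n × Fin n} {A : Matrix (Fin n) (Fin n) ℂ}
  {S : ℕ → Matrix (Fin n) (Fin n) ℂ}

theorem IsJacobiSequence.exists_isPlaneUnitary (hS : IsJacobiSequence I A S)
    (hI : ∀ k, (I k).1 ≠ (I k).2) (k : ℕ) :
    ∃ U, IsPlaneUnitary (I k).1 (I k).2 U ∧ S (k + 1) = Uᴴ * S k * U := by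
  obtain ⟨α, φ, h, hU⟩ := hS.2 k
  exact ⟨_, isPlaneUnitary_rotation α (hI k) h.2.1 h.2.2.1, hU⟩

theorem IsJacobiSequence.charpoly_eq (hS : IsJacobiSequence I A S)
    (hI : ∀ k, (I k).1 ≠ (I k).2) (k : ℕ) : (S k).charpoly = A.charpoly := by
  induction k with
  | zero => rw [hS.1]
  | succ k ih =>
    obtain ⟨U, hU, h⟩ := hS.exists_isPlaneUnitary hI k
    rw [h, hU.charpoly_conj, ih]

theorem IsJacobiSequence.frobSq_eq (hS : IsJacobiSequence I A S)
    (hI : ∀ k, (I k).1 ≠ (I k).2) (k : ℕ) : frobSq (S k) = frobSq A := by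
  induction k with
  | zero => rw [hS.1]
  | succ k ih =>
    obtain ⟨U, hU, h⟩ := hS.exists_isPlaneUnitary hI k
    rw [h, hU.frobSq_conj, ih]

theorem IsJacobiSequence.pivot_eq_zero (hS : IsJacobiSequence I A S) (hA : A.IsHermitian)
    (hI : ∀ k, (I k).1 ≠ (I k).2) (k : ℕ) : S (k + 1) (I k).1 (I k).2 = 0 := by
  obtain ⟨α, φ, h, hU⟩ := hS.2 k
  rw [hU, h.conj_pivot (hS.isHermitian hA k) (hI k)]

theorem IsJacobiSequence.diagSq_succ (hS : IsJacobiSequence I A S) (hA : A.IsHermitian)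
    (hI : ∀ k, (I k).1 ≠ (I k).2) (k : ℕ) :
    diagSq (S (k + 1)) = diagSq (S k) + 2 * ‖S k (I k).1 (I k).2‖ ^ 2 := by
  obtain ⟨α, φ, h, hU⟩ := hS.2 k
  rw [hU, h.diagSq_conj (hS.isHermitian hA k) (hI k)]

theorem IsJacobiSequence.abs_diag_sub_le (hS : IsJacobiSequence I A S) (hA : A.IsHermitian)
    (hI : ∀ k, (I k).1 ≠ (I k).2) (k : ℕ) (r : Fin n) :
    |(S (k + 1) r r).re - (S k r r).re| ≤ 2 * ‖S k (I k).1 (I k).2‖ := by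
  obtain ⟨α, φ, h, hU⟩ := hS.2 k
  rw [hU]
  exact h.abs_diag_sub_le (hS.isHermitian hA k) (hI k) r

theorem norm_apply_sq_le_frobSq (A : Matrix (Fin n) (Fin n) ℂ) (r s : Fin n) :
    ‖A r s‖ ^ 2 ≤ frobSq A :=
  (Finset.single_le_sum (f := fun s => ‖A r s‖ ^ 2) (fun _ _ => sq_nonneg _)
    (Finset.mem_univ s)).trans
    (Finset.single_le_sum (f := fun r => ∑ s, ‖A r s‖ ^ 2)
      (fun _ _ => Finset.sum_nonneg fun _ _ => sq_nonneg _) (Finset.mem_univ r))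

theorem IsJacobiSequence.norm_apply_le (hS : IsJacobiSequence I A S)
    (hI : ∀ k, (I k).1 ≠ (I k).2) (k : ℕ) (r s : Fin n) : ‖S k r s‖ ≤ √(frobSq A) :=
  Real.le_sqrt_of_sq_le (hS.frobSq_eq hI k ▸ norm_apply_sq_le_frobSq (S k) r s)

/-- The squared Frobenius norm of the off-diagonal part controls the off-diagonal entries. -/
theorem norm_apply_sq_le_frobSq_sub_diagSq {A : Matrix (Fin n) (Fin n) ℂ} {r s : Fin n}
    (hrs : r ≠ s) : ‖A r s‖ ^ 2 ≤ frobSq A - diagSq A := by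
  rw [frobSq, diagSq, ← Finset.sum_sub_distrib]
  have key : ∀ r, ∑ s, ‖A r s‖ ^ 2 - (A r r).re ^ 2 ≥ ∑ s ∈ Finset.univ.erase r, ‖A r s‖ ^ 2 := by
    intro r
    rw [← Finset.add_sum_erase _ _ (Finset.mem_univ r)]
    have : (A r r).re ^ 2 ≤ ‖A r r‖ ^ 2 := sq_le_sq.2 (by simpa using Complex.abs_re_le_norm _)
    linarith
  have h0 : ∀ r, 0 ≤ ∑ s ∈ Finset.univ.erase r, ‖A r s‖ ^ 2 := fun r =>
    Finset.sum_nonneg fun _ _ => sq_nonneg _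
  calc ‖A r s‖ ^ 2 ≤ ∑ s ∈ Finset.univ.erase r, ‖A r s‖ ^ 2 :=
        Finset.single_le_sum (f := fun s => ‖A r s‖ ^ 2) (fun _ _ => sq_nonneg _)
          (Finset.mem_erase.2 ⟨hrs.symm, Finset.mem_univ s⟩)
    _ ≤ ∑ s, ‖A r s‖ ^ 2 - (A r r).re ^ 2 := key r
    _ ≤ _ := Finset.single_le_sum (f := fun r => ∑ s, ‖A r s‖ ^ 2 - (A r r).re ^ 2)
          (fun r _ => (h0 r).trans (key r)) (Finset.mem_univ r)

theorem diagSq_le_frobSq (A : Matrix (Fin n) (Fin n) ℂ) : diagSq A ≤ frobSq A := by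
  refine Finset.sum_le_sum fun r _ => le_trans ?_ (Finset.single_le_sum
    (f := fun s => ‖A r s‖ ^ 2) (fun _ _ => sq_nonneg _) (Finset.mem_univ r))
  exact sq_le_sq.2 (by simpa using Complex.abs_re_le_norm _)

theorem diagSq_eq_frobSq {A : Matrix (Fin n) (Fin n) ℂ} (hA : A.IsHermitian)
    (h : IsDiagOn Set.univ A) : diagSq A = frobSq A := by
  refine Finset.sum_congr rfl fun r _ => ?_
  rw [Finset.sum_eq_single r (fun s _ hs => by rw [h r trivial s trivial hs.symm]; simp)
    (by simp), ← hA.coe_re_apply_self r]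
  simp

theorem continuous_diagSq : Continuous (diagSq : Matrix (Fin n) (Fin n) ℂ → ℝ) :=
  continuous_finsetSum _ fun r _ =>
    (Complex.continuous_re.comp (continuous_id.matrix_elem r r)).pow 2

theorem continuous_frobSq : Continuous (frobSq : Matrix (Fin n) (Fin n) ℂ → ℝ) :=
  continuous_finsetSum _ fun r _ => continuous_finsetSum _ fun s _ =>
    (continuous_id.matrix_elem r s).norm.pow 2

theorem IsJacobiSequence.exists_tendsto_diagSq (hS : IsJacobiSequence I A S) (hA : A.IsHermitian)
    (hI : ∀ k, (I k).1 ≠ (I k).2) : ∃ D, Tendsto (fun k => diagSq (S k)) atTop (𝓝 D) := by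
  refine ⟨_, tendsto_atTop_ciSup (monotone_nat_of_le_succ fun k => ?_) ⟨frobSq A, ?_⟩⟩
  · rw [hS.diagSq_succ hA hI]
    exact le_add_of_nonneg_right (by positivity)
  · rintro _ ⟨k, rfl⟩
    exact (diagSq_le_frobSq _).trans (hS.frobSq_eq hI k).le

theorem IsJacobiSequence.tendsto_pivot (hS : IsJacobiSequence I A S) (hA : A.IsHermitian)
    (hI : ∀ k, (I k).1 ≠ (I k).2) :
    Tendsto (fun k => ‖S k (I k).1 (I k).2‖) atTop (𝓝 0) := by
  obtain ⟨D, hD⟩ := hS.exists_tendsto_diagSq hA hI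
  have h1 := (((tendsto_add_atTop_iff_nat 1).2 hD).sub hD).div_const 2
  have h2 : (fun k => (diagSq (S (k + 1)) - diagSq (S k)) / 2) =
      fun k => ‖S k (I k).1 (I k).2‖ ^ 2 := by
    funext k
    rw [hS.diagSq_succ hA hI]
    ring
  rw [h2, sub_self, zero_div] at h1
  simpa [Real.sqrt_sq] using h1.sqrt

/-- Every defining condition is closed. -/
theorem isPlaneUnitary_of_tendsto {ι : Type*} {l : Filter ι} [l.NeBot] {i j : Fin n}
    {f : ι → Matrix (Fin n) (Fin n) ℂ} {U : Matrix (Fin n) (Fin n) ℂ} (h : Tendsto f l (𝓝 U))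
    (hf : ∀ k, IsPlaneUnitary i j (f k)) : IsPlaneUnitary i j U := by
  have ha := tendsto_matrix_apply h
  refine ⟨⟨fun r s h1 h2 => ?_, fun r s h1 h2 => ?_⟩, ?_, ?_, ?_⟩
  · exact tendsto_nhds_unique ((ha r s).congr fun k => (hf k).col r s h1 h2) tendsto_const_nhds
  · exact tendsto_nhds_unique ((ha r s).congr fun k => (hf k).row r s h1 h2) tendsto_const_nhds
  · rw [Matrix.mem_unitaryGroup_iff, Matrix.star_eq_conjTranspose]
    have hc : Continuous fun V : Matrix (Fin n) (Fin n) ℂ => V * Vᴴ :=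
      continuous_id.matrix_mul continuous_id.matrix_conjTranspose
    exact tendsto_nhds_unique (((hc.tendsto U).comp h).congr fun k =>
      (hf k).mul_conjTranspose_self) tendsto_const_nhds
  · exact ge_of_tendsto' (ha i i).norm fun k => (hf k).left
  · exact ge_of_tendsto' (ha j j).norm fun k => (hf k).right

/-- For a nondegenerate ordering the off-diagonal part converges to zero. -/
theorem IsJacobiSequence.tendsto_diagSq {O : List (Fin n × Fin n)} (hO : IsNondegenerate O)
    (hcyc : IsCyclicStrategy O I) (hS : IsJacobiSequence I A S) (hA : A.IsHermitian)
    (hI : ∀ k, (I k).1 ≠ (I k).2) :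
    Tendsto (fun k => diagSq (S k)) atTop (𝓝 (frobSq A)) := by
  obtain ⟨D, hD⟩ := hS.exists_tendsto_diagSq hA hI
  -- One ultrafilter serves all `t`, so that the limits at `t` and `t + 1` come from consecutive
  -- iterates.
  obtain ⟨𝒰, h𝒰⟩ := Ultrafilter.exists_le (atTop : Filter ℕ)
  have hM := hcyc.length_pos
  have hsub : ∀ t, Tendsto (fun m => t + O.length * m) 𝒰 atTop := fun t =>
    (tendsto_atTop_mono (fun m => show m ≤ t + O.length * m by nlinarith) tendsto_id).mono_left h𝒰
  choose U hU hSU using hS.exists_isPlaneUnitary hI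
  have hL : ∀ t, ∃ L, Tendsto (fun m => S (t + O.length * m)) 𝒰 (𝓝 L) := fun t =>
    exists_tendsto_of_bounded 𝒰 _ _ fun m r s => hS.norm_apply_le hI _ r s
  -- The angles need not depend continuously on the matrix, so the rotations are given limits of
  -- their own; a null step only asks for some plane unitary.
  have hV : ∀ t, ∃ V, Tendsto (fun m => U (t + O.length * m)) 𝒰 (𝓝 V) := fun t =>
    exists_tendsto_of_bounded 𝒰 _ 1 fun m r s => entry_norm_bound_of_unitary (hU _).mem r s
  choose L hL using hL
  choose V hV using hV
  have hLH : ∀ t, (L t).IsHermitian := fun t =>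
    tendsto_nhds_unique (((continuous_id.matrix_conjTranspose.tendsto (L t)).comp (hL t)).congr
      fun m => hS.isHermitian hA _) (hL t)
  have hnull : ∀ t, NullStep (I t) (L t) (L (t + 1)) := by
    intro t
    refine ⟨hI t, hLH t, ?_, ?_, V t, isPlaneUnitary_of_tendsto (hV t) fun m => ?_, ?_⟩
    · have h1 := (hS.tendsto_pivot hA hI).comp (hsub t)
      simp only [Function.comp_def, hcyc.add_mul] at h1
      exact norm_eq_zero.1 (tendsto_nhds_unique (tendsto_matrix_apply (hL t) _ _).norm h1)
    · refine tendsto_nhds_unique (tendsto_matrix_apply (hL (t + 1)) _ _)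
        (tendsto_const_nhds.congr fun m => ?_)
      have := hS.pivot_eq_zero hA hI (t + O.length * m)
      rw [hcyc.add_mul] at this
      rw [Nat.add_right_comm, this]
    · have := hU (t + O.length * m)
      rwa [hcyc.add_mul] at this
    · have hc : Continuous fun p : Matrix (Fin n) (Fin n) ℂ × Matrix (Fin n) (Fin n) ℂ =>
          p.1ᴴ * p.2 * p.1 :=
        (continuous_fst.matrix_conjTranspose.matrix_mul continuous_snd).matrix_mul continuous_fst
      refine tendsto_nhds_unique (hL (t + 1))
        (((hc.tendsto (V t, L t)).comp ((hV t).prodMk_nhds (hL t))).congr fun m => ?_)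
      rw [Nat.add_right_comm, hSU]
      rfl
  obtain ⟨N, hN⟩ := hO
  have hdiag := hN _ _ (hcyc.nullPath_repeated hnull N)
  -- The diagonal limit `L 0` identifies `D`: its diagonal carries its whole squared norm, which is
  -- that of `A`.
  have h1 : diagSq (L 0) = D :=
    tendsto_nhds_unique ((continuous_diagSq.tendsto _).comp (hL 0)) (hD.comp (hsub 0))
  have h2 : frobSq (L 0) = frobSq A :=
    tendsto_nhds_unique ((continuous_frobSq.tendsto _).comp (hL 0))
      (tendsto_const_nhds.congr fun m => (hS.frobSq_eq hI _).symm)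
  rwa [← h2, ← diagSq_eq_frobSq (hLH 0) hdiag, h1]

theorem IsJacobiSequence.tendsto_offDiag {O : List (Fin n × Fin n)} (hO : IsNondegenerate O)
    (hcyc : IsCyclicStrategy O I) (hS : IsJacobiSequence I A S) (hA : A.IsHermitian)
    (hI : ∀ k, (I k).1 ≠ (I k).2) {r s : Fin n} (hrs : r ≠ s) :
    Tendsto (fun k => S k r s) atTop (𝓝 0) := by
  have h1 := (hS.tendsto_diagSq hO hcyc hA hI).const_sub (frobSq A)
  rw [sub_self] at h1
  have h2 := squeeze_zero (fun k => sq_nonneg ‖S k r s‖)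
    (fun k => (norm_apply_sq_le_frobSq_sub_diagSq hrs).trans_eq (by rw [hS.frobSq_eq hI])) h1
  rw [tendsto_zero_iff_norm_tendsto_zero]
  simpa [Real.sqrt_sq] using h2.sqrt

theorem IsJacobiSequence.tendsto_of_isNondegenerate {O : List (Fin n × Fin n)}
    (hO : IsNondegenerate O) (hcyc : IsCyclicStrategy O I) (hS : IsJacobiSequence I A S)
    (hA : A.IsHermitian) (hI : ∀ k, (I k).1 ≠ (I k).2) :
    ∃ d : Fin n → ℝ, Tendsto S atTop (𝓝 (Matrix.diagonal fun i => (d i : ℂ))) ∧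
      ∃ σ : Equiv.Perm (Fin n), ∀ i, d i = hA.eigenvalues (σ i) := by
  have hoff := fun r s => hS.tendsto_offDiag hO hcyc hA hI (r := r) (s := s)
  -- Any limit matrix is diagonal with the characteristic polynomial of `A`, so its diagonal is one
  -- of finitely many arrangements of the eigenvalues.
  have hdiag : ∀ 𝒰 : Ultrafilter ℕ, (𝒰 : Filter ℕ) ≤ atTop →
      ∃ e ∈ Set.range fun σ : Equiv.Perm (Fin n) => fun i => hA.eigenvalues (σ i),
        Tendsto (fun k r => (S k r r).re) 𝒰 (𝓝 e) := by
    intro 𝒰 h𝒰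
    obtain ⟨L, hL⟩ := exists_tendsto_of_bounded 𝒰 S _ (hS.norm_apply_le hI)
    have hLH : L.IsHermitian :=
      tendsto_nhds_unique (((continuous_id.matrix_conjTranspose.tendsto L).comp hL).congr
        fun m => hS.isHermitian hA _) hL
    have hLd : Matrix.diagonal (fun i => ((L i i).re : ℂ)) = L := by
      ext r s
      by_cases hrs : r = s
      · subst hrs
        rw [Matrix.diagonal_apply_eq]
        exact hLH.coe_re_apply_self r
      · rw [Matrix.diagonal_apply_ne _ hrs]
        exact tendsto_nhds_unique ((hoff r s hrs).mono_left h𝒰) (tendsto_matrix_apply hL r s)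
    obtain ⟨σ, hσ⟩ := exists_perm_eigenvalues hA (fun i => (L i i).re)
      (by rw [hLd]; exact charpoly_eq_of_tendsto hL (hS.charpoly_eq hI))
    refine ⟨_, ⟨σ, rfl⟩, ?_⟩
    rw [tendsto_pi_nhds]
    intro r
    change Tendsto _ _ (𝓝 (hA.eigenvalues (σ r)))
    rw [← hσ r]
    exact (Complex.continuous_re.tendsto _).comp (tendsto_matrix_apply hL r r)
  have hdist : Tendsto (fun k => dist (fun r => (S (k + 1) r r).re) fun r => (S k r r).re)
      atTop (𝓝 0) := by
    refine squeeze_zero (fun _ => dist_nonneg) (fun k => ?_)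
      (by simpa using (hS.tendsto_pivot hA hI).const_mul 2)
    exact (dist_pi_le_iff (by positivity)).2 fun r => hS.abs_diag_sub_le hA hI k r
  obtain ⟨e, ⟨σ, rfl⟩, he⟩ := exists_tendsto_of_finite (Set.finite_range _) hdiag hdist
  refine ⟨_, tendsto_pi_nhds.2 fun r => tendsto_pi_nhds.2 fun s => ?_, σ, fun _ => rfl⟩
  by_cases hrs : r = s
  · subst hrs
    rw [Matrix.diagonal_apply_eq]
    refine ((Complex.continuous_ofReal.tendsto _).comp (tendsto_pi_nhds.1 he r)).congr fun k => ?_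
    exact (hS.isHermitian hA k).coe_re_apply_self r
  · rw [Matrix.diagonal_apply_ne _ hrs]
    exact hoff r s hrs

end Sequence

end ComplexJacobi

theorem mainTheorem7 {n : ℕ} (O : List (Fin n × Fin n))
    (hO : ComplexJacobi.IsGeneralizedSerial O)
    (I : ℕ → Fin n × Fin n) (hI : ComplexJacobi.IsCyclicStrategy O I)
    (A : Matrix (Fin n) (Fin n) ℂ) (hA : A.IsHermitian)
    (S : ℕ → Matrix (Fin n) (Fin n) ℂ) (hS : ComplexJacobi.IsJacobiSequence I A S) :
    ∃ d : Fin n → ℝ,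
      Tendsto S atTop (𝓝 (Matrix.diagonal fun i => (d i : ℂ))) ∧
      ∃ σ : Equiv.Perm (Fin n), ∀ i, d i = hA.eigenvalues (σ i) :=
  hS.tendsto_of_isNondegenerate hO.isNondegenerate hI hA fun k =>
    ((hO.1.2 (I k)).1 (List.mem_of_getElem? (hI k))).ne
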